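/- **Setting.** Let $\mathcal S,\mathcal A$ be finite sets, $\gamma\in(0,1)$, and let $\phi:\mathcal S\times\mathcal A\to\mathbb R^d$ be a feature map with $\|\phi(s,a)\|\le 1$ for all $(s,a)$. Let $\mathcal M$ be a linear MDP with these features: it has transition probabilities $p(s,a,s')=\phi(s,a)^\top\mu(s')$ and reward distributions $q(s,a,\cdot)$ supported in $[0,1]$ with means $\phi(s,a)^\top\theta$, where $\theta\in\mathbb R^d$ and $\mu(s')\in\mathbb R^d$ $(s'\in\mathcal S)$ satisfy $\|\theta\|\le\sqrt d$ and $\big\|\sum_{s}|\mu(s)|\big\|\le\sqrt d$ (absolute values taken coordinatewise). In each round $\ell=1,2,\dots$ an arbitrary, possibly randomized, sampling rule selects a pair $(s_\ell,a_\ell)$ depending on past observations; then a reward $r_\ell\sim q(s_\ell,a_\ell,\cdot)$ and a next state $s'_\ell\sim p(s_\ell,a_\ell,\cdot)$ are drawn, independently of each other and of the past given $(s_\ell,a_\ell)$. Let $\Phi_t\in\mathbb R^{t\times d}$ have rows $\phi(s_\ell,a_\ell)^\top$, $\ell\le t$, let $\omega_t(s,a)$ be the fraction of the first $t$ rounds in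 which $(s,a)$ was selected, and let $\Lambda(\omega)=\sum_{s,a}\omega_{s,a}\phi(s,a)\phi(s,a)^\top$. The $\tfrac1d$-regularized least-squares estimators are $$\hat\theta_t=\big(\Phi_t^\top\Phi_t+\tfrac1d I_d\big)^{-1}\Phi_t^\top(r_1,\dots,r_t)^\top,\qquad \hat\mu_t(s)=\big(\Phi_t^\top\Phi_t+\tfrac1d I_d\big)^{-1}\Phi_t^\top(1_{\{s=s'_1\}},\dots,1_{\{s=s'_t\}})^\top .$$ Let $\widehat V_t^\star:\mathcal S\to\mathbb R$ denote an optimal value function of the estimated model $\widehat{\mathcal M}_t$ with parameters $(\hat\theta_t,\hat\mu_t)$, i.e. a solution of $$\widehat V_t^\star(s)=\max_{a\in\mathcal A}\phi(s,a)^\top\Big(\hat\theta_t+\gamma\sum_{s'\in\mathcal S}\widehat V_t^\star(s')\,\hat\mu_t(s')\Big)\quad (s\in\mathcal S),\qquad\text{with } 0\le\widehat V_t^\star\le\frac1{1-\gamma}.$$ The weights $\phi(s,a)^\top\hat\mu_t(s')$ need not form a probability vector, so such a solution need not exist for every $t$; the bound below is asserted for every $t$ at which one exists, and for every such solution. **Proposition.**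 Let $\delta\in(0,1)$. Regardless of the sampling rule, with probability at least $1-\delta$, simultaneously for all $t\ge1$ and for every such $\widehat V_t^\star$, $$\Big\|\hat\theta_t-\theta+\gamma(\hat\mu_t-\mu)^\top\widehat V_t^\star\Big\|^2_{t\Lambda(\omega_t)}\le\frac{2}{(1-\gamma)^2}\left(2\log\Big(\frac{\sqrt e\,\zeta(2)\,t^2}{\delta}\Big)+d\log\big(8e^4dt^2\big)\right),$$ where $(\hat\mu_t-\mu)^\top V=\sum_{s}V(s)(\hat\mu_t(s)-\mu(s))$ and $\|x\|_B^2=x^\top Bx$. -/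

import Mathlib

open MeasureTheory ProbabilityTheory Matrix

namespace LinMDP

/-- A linear MDP with finite state space `S`, finite action space `A` and feature map
`φ : S → A → ℝ^d`: transition probabilities `p s a s'`, reward laws `q s a` on `[0, 1]`, and
parameters `θ`, `μ` with `p s a s' = φ(s,a)ᵀ μ(s')` and `r(s,a) = 𝔼[q s a] = φ(s,a)ᵀ θ`. -/
structure LinearMDP (S A : Type*) [Fintype S] (d : ℕ) (φ : S → A → Fin d → ℝ) where
  /-- transition probabilities -/
  p : S → A → S → ℝ
  p_nonneg : ∀ s a s', 0 ≤ p s a s'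
  p_sum : ∀ s a, ∑ s', p s a s' = 1
  /-- reward distributions -/
  q : S → A → Measure ℝ
  q_prob : ∀ s a, IsProbabilityMeasure (q s a)
  q_supp : ∀ s a, q s a (Set.Icc 0 1)ᶜ = 0
  /-- reward parameter -/
  θ : Fin d → ℝ
  /-- transition parameter (`μ s'` is the row of index `s'` of an `S × d` matrix) -/
  μ : S → Fin d → ℝ
  p_linear : ∀ s a s', p s a s' = φ s a ⬝ᵥ μ s'
  r_linear : ∀ s a, ∫ x, x ∂(q s a) = φ s a ⬝ᵥ θ
  θ_norm : ‖WithLp.toLp 2 θ‖ ≤ √(d : ℝ)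
  μ_norm : ‖WithLp.toLp 2 (fun i => ∑ s, |μ s i|)‖ ≤ √(d : ℝ)

/-- Data gathered from the MDP `M` under an arbitrary, possibly randomized, sampling rule.
Index `ℓ` stands for round `ℓ + 1`, and `ℱ ℓ` is what is known after `ℓ` rounds, including the
randomization used to choose the next pair. The pair `(s ℓ, a ℓ)` is any function of that
information; given it, the reward `r ℓ` and the next state `s' ℓ` are drawn independently
from `M.q (s ℓ) (a ℓ)` and `M.p (s ℓ) (a ℓ)`. -/
structure IsSampling {S A : Type*} [Fintype S] [MeasurableSpace S] [MeasurableSpace A]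
    {d : ℕ} {φ : S → A → Fin d → ℝ} (M : LinearMDP S A d φ)
    {Ω : Type*} {mΩ : MeasurableSpace Ω} (P : Measure Ω) (ℱ : Filtration ℕ mΩ)
    (s : ℕ → Ω → S) (a : ℕ → Ω → A) (r : ℕ → Ω → ℝ) (s' : ℕ → Ω → S) : Prop where
  meas_s : ∀ ℓ, Measurable[ℱ ℓ] (s ℓ)
  meas_a : ∀ ℓ, Measurable[ℱ ℓ] (a ℓ)
  meas_r : ∀ ℓ, Measurable[ℱ (ℓ + 1)] (r ℓ)
  meas_s' : ∀ ℓ, Measurable[ℱ (ℓ + 1)] (s' ℓ)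
  cond_law : ∀ (ℓ : ℕ) (B : Set ℝ) (y : S), MeasurableSet B →
    P[Set.indicator {ω | r ℓ ω ∈ B ∧ s' ℓ ω = y} (fun _ => (1 : ℝ)) | ℱ ℓ]
      =ᵐ[P] fun ω => (M.q (s ℓ ω) (a ℓ ω)).real B * M.p (s ℓ ω) (a ℓ ω) y

section Estimators

variable {S A : Type*} {d : ℕ}

/-- The `t × d` matrix `Φ_t` whose rows are the features of the first `t` sampled pairs. -/
def designMatrix (φ : S → A → Fin d → ℝ) (s : ℕ → S) (a : ℕ → A) (t : ℕ) :
    Matrix (Fin t) (Fin d) ℝ :=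
  Matrix.of fun ℓ => φ (s ℓ) (a ℓ)

/-- The `lam`-regularized least-squares estimator
`(Φ_tᵀ Φ_t + lam I)⁻¹ Φ_tᵀ Y_t` with responses `Y_t = (y_1, …, y_t)`. -/
noncomputable def ridge (lam : ℝ) (φ : S → A → Fin d → ℝ) (s : ℕ → S) (a : ℕ → A)
    (y : ℕ → ℝ) (t : ℕ) : Fin d → ℝ :=
  ((designMatrix φ s a t)ᵀ * designMatrix φ s a t + lam • (1 : Matrix (Fin d) (Fin d) ℝ))⁻¹ *ᵥ
    ((designMatrix φ s a t)ᵀ *ᵥ fun ℓ : Fin t => y ℓ)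

/-- `θ̂_t`: the estimator with the rewards as responses. -/
noncomputable def thetaHat (lam : ℝ) (φ : S → A → Fin d → ℝ) (s : ℕ → S) (a : ℕ → A)
    (r : ℕ → ℝ) (t : ℕ) : Fin d → ℝ :=
  ridge lam φ s a r t

open Classical in
/-- `μ̂_t(x)`: the estimator with responses `1_{x = s'_ℓ}`. -/
noncomputable def muHat (lam : ℝ) (φ : S → A → Fin d → ℝ) (s : ℕ → S) (a : ℕ → A)
    (s' : ℕ → S) (t : ℕ) (x : S) : Fin d → ℝ :=
  ridge lam φ s a (fun ℓ => if x = s' ℓ then 1 else 0) t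

open Classical in
/-- `ω_t(x, b) = N_t(x, b) / t`: the frequency of the pair `(x, b)` in the first `t` rounds. -/
noncomputable def freq (s : ℕ → S) (a : ℕ → A) (t : ℕ) (x : S) (b : A) : ℝ :=
  (((Finset.range t).filter fun ℓ => s ℓ = x ∧ a ℓ = b).card : ℝ) / t

/-- The feature matrix `Λ(w) = ∑_{x,b} w_{x,b} φ(x,b) φ(x,b)ᵀ`. -/
def featureMatrix [Fintype S] [Fintype A] (φ : S → A → Fin d → ℝ) (w : S → A → ℝ) :
    Matrix (Fin d) (Fin d) ℝ :=
  ∑ x, ∑ b, w x b • Matrix.vecMulVec (φ x b) (φ x b)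

/-- `‖x‖_B² = xᵀ B x`. -/
def sqNorm (B : Matrix (Fin d) (Fin d) ℝ) (x : Fin d → ℝ) : ℝ :=
  x ⬝ᵥ (B *ᵥ x)

/-- `V` is an optimal value function of the linear model with parameters `θ`, `μ` and discount
`γ`: it solves the Bellman optimality equation `V(x) = max_b Q(x, b)`, where
`Q(x, b) = φ(x,b)ᵀ θ + γ ∑_y φ(x,b)ᵀ μ(y) V(y)`.
The numbers `φ(x,b)ᵀ μ(y)` need not be probabilities. -/
def IsOptimalValue [Fintype S] (γ : ℝ) (φ : S → A → Fin d → ℝ) (θ : Fin d → ℝ)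
    (μ : S → Fin d → ℝ) (V : S → ℝ) : Prop :=
  ∀ x, IsGreatest (Set.range fun b => φ x b ⬝ᵥ θ + γ * ∑ y, (φ x b ⬝ᵥ μ y) * V y) (V x)

end Estimators

end LinMDP

/-! Put B = 1/(1-γ), used throughout as the solution of 1 + γB = B. Ridge regression is linear in
its responses, so `θ̂ + γ ∑ V(x) μ̂(x)` is the ridge estimator v for the targets y = r + γV(s'),
whose conditional means for a fixed V are linear in the features, with parameter w = `valueParam M γ
V`. With u = v - w and noise η = y - φᵀw, the normal equations give ∑ (φᵀu)² ≤ ∑ η φᵀu + ‖w‖²/(4d),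
and ‖w‖² ≤ dB².

For fixed V and u, Hoeffding's lemma controls ∑ η φᵀu by an exponential supermartingale. Here both
depend on the data, but the Bellman equation makes V the greedy value of v, hence a function of d
real numbers whatever the size of `S`. A lattice for v and another for u therefore suffice, at a
cost of 2d logarithms of the number of points per axis. Markov's inequality and union bounds over
lattice pairs and over t, with weights δ/(ζ(2)t²), finish the probabilistic part; no maximal
inequality is needed. The existence or uniqueness of V plays no role.

The main steps are `IsSampling.measure_exists_le_sum_logIncrement_le` (probability),
`sum_sq_le_of_perturbation` (discretization) and `sqNorm_le_of_sum_logIncrement_le` (their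
combination on a fixed path). -/

namespace LinMDP

/-! ### Integration against one sampling step -/

section Sampling

variable {S A : Type*} [Fintype S]
  [MeasurableSpace S] [MeasurableSingletonClass S] [MeasurableSpace A]
  {d : ℕ} {φ : S → A → Fin d → ℝ} {M : LinearMDP S A d φ}
  {Ω : Type*} {mΩ : MeasurableSpace Ω} {P : Measure Ω} [IsProbabilityMeasure P]
  {ℱ : Filtration ℕ mΩ}
  {s : ℕ → Ω → S} {a : ℕ → Ω → A} {r : ℕ → Ω → ℝ} {s' : ℕ → Ω → S}

theorem IsSampling.measure_inter_eq (h : IsSampling M P ℱ s a r s') (ℓ : ℕ) (x : S) (b : A) (y : S)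
    {F : Set Ω} (hF : MeasurableSet[ℱ ℓ] F) (hFx : ∀ ω ∈ F, s ℓ ω = x ∧ a ℓ ω = b)
    {B : Set ℝ} (hB : MeasurableSet B) :
    P (F ∩ {ω | r ℓ ω ∈ B ∧ s' ℓ ω = y}) =
      P F * ENNReal.ofReal (M.p x b y) * M.q x b B := by
  have := M.q_prob x b
  have hr : Measurable (r ℓ) := (h.meas_r ℓ).mono (ℱ.le _) le_rfl
  have hs' : Measurable (s' ℓ) := (h.meas_s' ℓ).mono (ℱ.le _) le_rfl
  have hE : MeasurableSet {ω | r ℓ ω ∈ B ∧ s' ℓ ω = y} :=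
    (hr hB).inter (hs' (measurableSet_singleton y))
  have hF' : MeasurableSet F := ℱ.le _ _ hF
  have h1 := setIntegral_condExp (ℱ.le ℓ) (μ := P)
    (f := Set.indicator {ω | r ℓ ω ∈ B ∧ s' ℓ ω = y} (fun _ => (1 : ℝ)))
    ((integrable_const 1).indicator hE) hF
  rw [setIntegral_congr_ae (g := fun _ => (M.q x b).real B * M.p x b y) hF'
    ((h.cond_law ℓ B y hB).mono fun ω hω hωF => by
      simp only [hω, (hFx ω hωF).1, (hFx ω hωF).2])] at h1
  rw [setIntegral_const, setIntegral_indicator hE, setIntegral_const, smul_eq_mul, smul_eq_mul,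
    mul_one] at h1
  rw [← ofReal_measureReal (μ := P) (s := F ∩ _), ← h1, ENNReal.ofReal_mul measureReal_nonneg,
    ENNReal.ofReal_mul measureReal_nonneg, ofReal_measureReal, ofReal_measureReal]
  ring

variable [Fintype A] [MeasurableSingletonClass A]

/-- The finitely many values of the pair and the next state partition F; on each piece the law of
the reward is a multiple of `M.q x b`. -/
theorem IsSampling.setLIntegral_le (h : IsSampling M P ℱ s a r s') (ℓ : ℕ)
    {g : S → A → ℝ → S → ENNReal} (hg : ∀ x b y, Measurable fun ρ => g x b ρ y) {C : ENNReal}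
    (hC : ∀ x b, ∑ y, ENNReal.ofReal (M.p x b y) * ∫⁻ ρ, g x b ρ y ∂M.q x b ≤ C)
    {F : Set Ω} (hF : MeasurableSet[ℱ ℓ] F) :
    ∫⁻ ω in F, g (s ℓ ω) (a ℓ ω) (r ℓ ω) (s' ℓ ω) ∂P ≤ C * P F := by
  classical
  have hr : Measurable (r ℓ) := (h.meas_r ℓ).mono (ℱ.le _) le_rfl
  have hs' : Measurable (s' ℓ) := (h.meas_s' ℓ).mono (ℱ.le _) le_rfl
  have hFxb : ∀ x b, MeasurableSet[ℱ ℓ] (F ∩ {ω | s ℓ ω = x ∧ a ℓ ω = b}) := fun x b =>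
    hF.inter ((h.meas_s ℓ (measurableSet_singleton x)).inter
      (h.meas_a ℓ (measurableSet_singleton b)))
  have hE : ∀ x b y, MeasurableSet (F ∩ {ω | s ℓ ω = x ∧ a ℓ ω = b} ∩ {ω | s' ℓ ω = y}) :=
    fun x b y => (ℱ.le _ _ (hFxb x b)).inter (hs' (measurableSet_singleton y))
  have hpiece : ∀ x b y, ∫⁻ ω in F ∩ {ω | s ℓ ω = x ∧ a ℓ ω = b} ∩ {ω | s' ℓ ω = y},
      g x b (r ℓ ω) y ∂P = P (F ∩ {ω | s ℓ ω = x ∧ a ℓ ω = b}) *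
        (ENNReal.ofReal (M.p x b y) * ∫⁻ ρ, g x b ρ y ∂M.q x b) := by
    intro x b y
    have hmap : (P.restrict (F ∩ {ω | s ℓ ω = x ∧ a ℓ ω = b} ∩ {ω | s' ℓ ω = y})).map (r ℓ) =
        (P (F ∩ {ω | s ℓ ω = x ∧ a ℓ ω = b}) * ENNReal.ofReal (M.p x b y)) • M.q x b := by
      ext B hB
      rw [Measure.map_apply hr hB, Measure.restrict_apply (hr hB), Measure.smul_apply,
        smul_eq_mul, ← h.measure_inter_eq ℓ x b y (hFxb x b) (fun ω hω => hω.2) hB]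
      congr 1
      ext ω
      simp only [Set.mem_inter_iff, Set.mem_preimage, Set.mem_ofPred_eq]
      tauto
    rw [← lintegral_map (hg x b y) hr, hmap, lintegral_smul_measure, smul_eq_mul, mul_assoc]
  have hsum : ∀ ω, F.indicator (fun ω => g (s ℓ ω) (a ℓ ω) (r ℓ ω) (s' ℓ ω)) ω =
      ∑ x, ∑ b, ∑ y, (F ∩ {ω | s ℓ ω = x ∧ a ℓ ω = b} ∩ {ω | s' ℓ ω = y}).indicator
        (fun ω => g x b (r ℓ ω) y) ω := by
    intro ω
    rw [Finset.sum_eq_single (s ℓ ω), Finset.sum_eq_single (a ℓ ω),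
      Finset.sum_eq_single (s' ℓ ω)]
    · by_cases hω : ω ∈ F <;> simp [hω, Set.indicator]
    all_goals simp +contextual [Set.indicator, eq_comm]
  have hP : ∑ x, ∑ b, P (F ∩ {ω | s ℓ ω = x ∧ a ℓ ω = b}) = P F := by
    have h1 : ∀ ω, F.indicator (fun _ => (1 : ENNReal)) ω =
        ∑ x, ∑ b, (F ∩ {ω | s ℓ ω = x ∧ a ℓ ω = b}).indicator (fun _ => 1) ω := by
      intro ω
      rw [Finset.sum_eq_single (s ℓ ω), Finset.sum_eq_single (a ℓ ω)]
      · by_cases hω : ω ∈ F <;> simp [hω, Set.indicator]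
      all_goals simp +contextual [Set.indicator, eq_comm]
    have hm : ∀ x b, MeasurableSet (F ∩ {ω | s ℓ ω = x ∧ a ℓ ω = b}) :=
      fun x b => ℱ.le _ _ (hFxb x b)
    have h2 := lintegral_congr (μ := P) h1
    rw [lintegral_indicator (ℱ.le _ _ hF), setLIntegral_one, lintegral_finsetSum _ fun x _ =>
      Finset.measurable_sum _ fun b _ => measurable_const.indicator (hm x b)] at h2
    rw [h2]
    refine Finset.sum_congr rfl fun x _ => ?_
    rw [lintegral_finsetSum _ fun b _ => measurable_const.indicator (hm x b)]
    refine Finset.sum_congr rfl fun b _ => ?_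
    rw [lintegral_indicator (hm x b), setLIntegral_one]
  have hm : ∀ x b y, Measurable ((F ∩ {ω | s ℓ ω = x ∧ a ℓ ω = b} ∩ {ω | s' ℓ ω = y}).indicator
      fun ω => g x b (r ℓ ω) y) := fun x b y => ((hg x b y).comp hr).indicator (hE x b y)
  rw [← lintegral_indicator (ℱ.le _ _ hF), lintegral_congr hsum, lintegral_finsetSum _ fun x _ =>
    Finset.measurable_sum _ fun b _ => Finset.measurable_sum _ fun y _ => hm x b y, ← hP,
    Finset.mul_sum]
  refine Finset.sum_le_sum fun x _ => ?_
  rw [lintegral_finsetSum _ fun b _ => Finset.measurable_sum _ fun y _ => hm x b y,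
    Finset.mul_sum]
  refine Finset.sum_le_sum fun b _ => ?_
  rw [lintegral_finsetSum _ fun y _ => hm x b y]
  simp_rw [lintegral_indicator (hE x b _), hpiece]
  rw [← Finset.mul_sum, mul_comm]
  gcongr
  exact hC x b

/-- This is the supermartingale step. The bound on sets of `ℱ ℓ` says that the measure with density
g is dominated by P on `ℱ ℓ`, so every `ℱ ℓ`-measurable G may be integrated against both; no
conditional expectation of g is formed. -/
theorem IsSampling.lintegral_mul_le (h : IsSampling M P ℱ s a r s') (ℓ : ℕ)
    {g : S → A → ℝ → S → ENNReal} (hg : ∀ x b y, Measurable fun ρ => g x b ρ y)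
    (hgm : Measurable fun ω => g (s ℓ ω) (a ℓ ω) (r ℓ ω) (s' ℓ ω))
    (hC : ∀ x b, ∑ y, ENNReal.ofReal (M.p x b y) * ∫⁻ ρ, g x b ρ y ∂M.q x b ≤ 1)
    {G : Ω → ENNReal} (hG : Measurable[ℱ ℓ] G) :
    ∫⁻ ω, G ω * g (s ℓ ω) (a ℓ ω) (r ℓ ω) (s' ℓ ω) ∂P ≤ ∫⁻ ω, G ω ∂P := by
  have hG' : Measurable G := hG.mono (ℱ.le _) le_rfl
  have hle : (P.withDensity fun ω => g (s ℓ ω) (a ℓ ω) (r ℓ ω) (s' ℓ ω)).trim (ℱ.le ℓ) ≤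
      P.trim (ℱ.le ℓ) := by
    refine Measure.le_iff.2 fun F hF => ?_
    rw [trim_measurableSet_eq _ hF, trim_measurableSet_eq _ hF,
      withDensity_apply _ (ℱ.le _ _ hF)]
    simpa using h.setLIntegral_le ℓ hg hC hF
  have h2 := lintegral_mono' hle (le_refl G)
  rw [lintegral_trim _ hG, lintegral_trim _ hG, lintegral_withDensity_eq_lintegral_mul _ hgm hG']
    at h2
  simpa [mul_comm] using h2

theorem IsSampling.ae_reward_mem (h : IsSampling M P ℱ s a r s') :
    ∀ᵐ ω ∂P, ∀ ℓ, r ℓ ω ∈ Set.Icc (0 : ℝ) 1 := by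
  refine ae_all_iff.2 fun ℓ => ?_
  have hr : Measurable (r ℓ) := (h.meas_r ℓ).mono (ℱ.le _) le_rfl
  have h1 := h.setLIntegral_le ℓ (g := fun _ _ ρ _ => (Set.Icc (0 : ℝ) 1)ᶜ.indicator 1 ρ) (C := 0)
    (fun _ _ _ => measurable_one.indicator measurableSet_Icc.compl)
    (fun x b => by simp [lintegral_indicator_one measurableSet_Icc.compl, M.q_supp])
    (MeasurableSet.univ (m := ℱ ℓ))
  rw [setLIntegral_univ, zero_mul, nonpos_iff_eq_zero] at h1
  have h2 : ∫⁻ ω, ((r ℓ) ⁻¹' (Set.Icc (0 : ℝ) 1)ᶜ).indicator 1 ω ∂P = 0 := h1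
  rw [lintegral_indicator_one (hr measurableSet_Icc.compl)] at h2
  exact h2

end Sampling

/-! ### Hoeffding's lemma for rewards and for next states -/

section Hoeffding

theorem integral_exp_mul_le_of_mem_Icc {Ω : Type*} {m : MeasurableSpace Ω} (ν : Measure Ω)
    [IsProbabilityMeasure ν] {X : Ω → ℝ} (hX : AEMeasurable X ν) {c : ℝ}
    (hc : ∀ᵐ ω ∂ν, X ω ∈ Set.Icc 0 c) (k : ℝ) :
    ∫⁻ ω, ENNReal.ofReal (Real.exp (k * (X ω - ∫ x, X x ∂ν))) ∂ν ≤
      ENNReal.ofReal (Real.exp (k ^ 2 * c ^ 2 / 8)) := by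
  have h := hasSubgaussianMGF_of_mem_Icc hX hc
  rw [← ofReal_integral_eq_lintegral_ofReal (h.integrable_exp_mul k)
    (Filter.Eventually.of_forall fun _ => (Real.exp_pos _).le)]
  refine ENNReal.ofReal_le_ofReal ((h.mgf_le k).trans (le_of_eq ?_))
  congr 1
  simp [div_pow]
  ring

theorem sum_mul_exp_le {S : Type*} [Fintype S] {p : S → ℝ} (hp : ∀ y, 0 ≤ p y)
    (hp1 : ∑ y, p y = 1) {X : S → ℝ} {c : ℝ} (hX : ∀ y, X y ∈ Set.Icc 0 c) (k : ℝ) :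
    ∑ y, ENNReal.ofReal (p y) * ENNReal.ofReal (Real.exp (k * (X y - ∑ z, p z * X z))) ≤
      ENNReal.ofReal (Real.exp (k ^ 2 * c ^ 2 / 8)) := by
  let _ : MeasurableSpace S := ⊤
  let ν : Measure S := ∑ y, ENNReal.ofReal (p y) • Measure.dirac y
  have hν : IsProbabilityMeasure ν := ⟨by
    simp [ν, ← ENNReal.ofReal_sum_of_nonneg fun y _ => hp y, hp1]⟩
  have h1 : ∫ x, X x ∂ν = ∑ z, p z * X z := by
    rw [integral_finsetSum_measure fun y _ => by
      exact Integrable.smul_measure (integrable_dirac (by simp)) ENNReal.ofReal_ne_top]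
    simp [hp]
  have h := integral_exp_mul_le_of_mem_Icc ν (X := X) Measurable.of_discrete.aemeasurable
    (Filter.Eventually.of_forall hX) k
  rw [h1] at h
  simpa [ν, lintegral_finsetSum_measure] using h

end Hoeffding

/-! ### Exponential supermartingale and union bound -/

section ExponentialBound

variable {S A : Type*} [Fintype S] {d : ℕ} {φ : S → A → Fin d → ℝ}

/-- The parameter of the linear function `r + γ P V` of the model `M`. -/
noncomputable def valueParam (M : LinearMDP S A d φ) (γ : ℝ) (V : S → ℝ) : Fin d → ℝ :=
  M.θ + γ • ∑ x, V x • M.μ x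

/-- The deviation of the one-step target `ρ + γ V y` from its mean. -/
noncomputable def noise (M : LinearMDP S A d φ) (γ : ℝ) (V : S → ℝ) (x : S) (b : A) (ρ : ℝ)
    (y : S) : ℝ :=
  ρ + γ * V y - φ x b ⬝ᵥ valueParam M γ V

/-- One summand of the logarithm of the exponential supermartingale in direction `v`. -/
noncomputable def logIncrement (M : LinearMDP S A d φ) (γ B κ : ℝ) (V : S → ℝ) (v : Fin d → ℝ)
    (x : S) (b : A) (ρ : ℝ) (y : S) : ℝ :=
  κ * (φ x b ⬝ᵥ v) * noise M γ V x b ρ y - κ ^ 2 * B ^ 2 / 8 * (φ x b ⬝ᵥ v) ^ 2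

theorem dotProduct_valueParam (M : LinearMDP S A d φ) (γ : ℝ) (V : S → ℝ) (x : S) (b : A) :
    φ x b ⬝ᵥ valueParam M γ V = ∫ ρ, ρ ∂M.q x b + γ * ∑ y, M.p x b y * V y := by
  simp only [valueParam, dotProduct_add, dotProduct_smul, dotProduct_sum, M.r_linear,
    M.p_linear, smul_eq_mul]
  simp only [mul_comm]

/-- Given the pair, reward and next state are independent, so the exponential moment factors.
Hoeffding is applied to each factor, with ranges 1 for the reward and B for V at scale γ. -/
theorem sum_lintegral_exp_logIncrement_le (M : LinearMDP S A d φ) {γ B : ℝ} (hγ : 0 ≤ γ)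
    (hB : 1 + γ * B = B) (hB0 : 0 ≤ B) (κ : ℝ) {V : S → ℝ} (hV : ∀ x, V x ∈ Set.Icc 0 B)
    (v : Fin d → ℝ) (x : S) (b : A) :
    ∑ y, ENNReal.ofReal (M.p x b y) *
      ∫⁻ ρ, ENNReal.ofReal (Real.exp (logIncrement M γ B κ V v x b ρ y)) ∂M.q x b ≤ 1 := by
  have := M.q_prob x b
  set k := κ * (φ x b ⬝ᵥ v) with hk
  have h1 := integral_exp_mul_le_of_mem_Icc (M.q x b) (X := fun ρ => ρ) (c := 1)
    measurable_id.aemeasurable (M.q_supp x b) k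
  have h2 := sum_mul_exp_le (M.p_nonneg x b) (M.p_sum x b) hV (k * γ)
  have hsplit : ∀ ρ y, ENNReal.ofReal (Real.exp (logIncrement M γ B κ V v x b ρ y)) =
      ENNReal.ofReal (Real.exp (k * (ρ - ∫ ρ, ρ ∂M.q x b))) *
      (ENNReal.ofReal (Real.exp (k * γ * (V y - ∑ z, M.p x b z * V z))) *
        ENNReal.ofReal (Real.exp (-(k ^ 2 * B ^ 2 / 8)))) := by
    intro ρ y
    rw [← ENNReal.ofReal_mul (Real.exp_pos _).le, ← ENNReal.ofReal_mul (Real.exp_pos _).le,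
      ← Real.exp_add, ← Real.exp_add]
    congr 2
    rw [logIncrement, noise, dotProduct_valueParam, hk]
    ring
  have h3 : ∀ y, ∫⁻ ρ, ENNReal.ofReal (Real.exp (logIncrement M γ B κ V v x b ρ y)) ∂M.q x b =
      (∫⁻ ρ, ENNReal.ofReal (Real.exp (k * (ρ - ∫ ρ, ρ ∂M.q x b))) ∂M.q x b) *
      (ENNReal.ofReal (Real.exp (k * γ * (V y - ∑ z, M.p x b z * V z))) *
        ENNReal.ofReal (Real.exp (-(k ^ 2 * B ^ 2 / 8)))) := by
    intro y
    simp_rw [hsplit]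
    rw [lintegral_mul_const _ (by fun_prop)]
  simp_rw [h3]
  calc _ = (∫⁻ ρ, ENNReal.ofReal (Real.exp (k * (ρ - ∫ ρ, ρ ∂M.q x b))) ∂M.q x b) *
        (∑ y, ENNReal.ofReal (M.p x b y) *
          ENNReal.ofReal (Real.exp (k * γ * (V y - ∑ z, M.p x b z * V z)))) *
        ENNReal.ofReal (Real.exp (-(k ^ 2 * B ^ 2 / 8))) := by
        rw [Finset.mul_sum, Finset.sum_mul]
        exact Finset.sum_congr rfl fun y _ => by ring
    _ ≤ ENNReal.ofReal (Real.exp (k ^ 2 * 1 ^ 2 / 8)) *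
        ENNReal.ofReal (Real.exp ((k * γ) ^ 2 * B ^ 2 / 8)) *
        ENNReal.ofReal (Real.exp (-(k ^ 2 * B ^ 2 / 8))) := by gcongr
    _ ≤ 1 := by
        rw [← ENNReal.ofReal_mul (Real.exp_pos _).le, ← Real.exp_add,
          ← ENNReal.ofReal_mul (Real.exp_pos _).le, ← Real.exp_add, ENNReal.ofReal_le_one,
          Real.exp_le_one_iff]
        -- The two variance proxies add up to at most the square of the total range, 1 + γB = B.
        have h4 : 1 + (γ * B) ^ 2 ≤ B ^ 2 := by nlinarith [mul_nonneg hγ hB0]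
        nlinarith [mul_le_mul_of_nonneg_left h4 (sq_nonneg k)]

variable [Fintype A]
  [MeasurableSpace S] [MeasurableSingletonClass S]
  [MeasurableSpace A] [MeasurableSingletonClass A]
  {M : LinearMDP S A d φ}
  {Ω : Type*} {mΩ : MeasurableSpace Ω} {P : Measure Ω}
  {ℱ : Filtration ℕ mΩ}
  {s : ℕ → Ω → S} {a : ℕ → Ω → A} {r : ℕ → Ω → ℝ} {s' : ℕ → Ω → S}

theorem IsSampling.measurable_logIncrement (h : IsSampling M P ℱ s a r s') (γ B κ : ℝ) (V : S → ℝ)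
    (v : Fin d → ℝ) (ℓ : ℕ) :
    Measurable[ℱ (ℓ + 1)]
      fun ω => logIncrement M γ B κ V v (s ℓ ω) (a ℓ ω) (r ℓ ω) (s' ℓ ω) := by
  have hs : Measurable[ℱ (ℓ + 1)] (s ℓ) := (h.meas_s ℓ).mono (ℱ.mono ℓ.le_succ) le_rfl
  have ha : Measurable[ℱ (ℓ + 1)] (a ℓ) := (h.meas_a ℓ).mono (ℱ.mono ℓ.le_succ) le_rfl
  have hV : Measurable[ℱ (ℓ + 1)] fun ω => V (s' ℓ ω) :=
    (Measurable.of_discrete (f := V)).comp (h.meas_s' ℓ)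
  have hφ : ∀ v : Fin d → ℝ, Measurable[ℱ (ℓ + 1)] fun ω => φ (s ℓ ω) (a ℓ ω) ⬝ᵥ v := fun v =>
    (Measurable.of_discrete (f := fun z : S × A => φ z.1 z.2 ⬝ᵥ v)).comp (hs.prodMk ha)
  exact (((hφ v).const_mul κ).mul (((h.meas_r ℓ).add (hV.const_mul γ)).sub (hφ _))).sub
    (((hφ v).pow_const 2).const_mul _)

variable [IsProbabilityMeasure P]

theorem IsSampling.lintegral_exp_sum_le_one (h : IsSampling M P ℱ s a r s') {γ B : ℝ}
    (hγ : 0 ≤ γ) (hB : 1 + γ * B = B) (hB0 : 0 ≤ B) (κ : ℝ) {V : S → ℝ}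
    (hV : ∀ x, V x ∈ Set.Icc 0 B) (v : Fin d → ℝ) (t : ℕ) :
    ∫⁻ ω, ENNReal.ofReal (Real.exp (∑ ℓ ∈ Finset.range t,
      logIncrement M γ B κ V v (s ℓ ω) (a ℓ ω) (r ℓ ω) (s' ℓ ω))) ∂P ≤ 1 := by
  induction t with
  | zero => simp
  | succ t ih =>
    refine le_trans (le_of_eq ?_) ((h.lintegral_mul_le t
      (g := fun x b ρ y => ENNReal.ofReal (Real.exp (logIncrement M γ B κ V v x b ρ y)))
      (G := fun ω => ENNReal.ofReal (Real.exp (∑ ℓ ∈ Finset.range t,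
        logIncrement M γ B κ V v (s ℓ ω) (a ℓ ω) (r ℓ ω) (s' ℓ ω)))) ?_ ?_
      (sum_lintegral_exp_logIncrement_le M hγ hB hB0 κ hV v) ?_).trans ih)
    · refine lintegral_congr fun ω => ?_
      rw [Finset.sum_range_succ, Real.exp_add, ENNReal.ofReal_mul (Real.exp_pos _).le]
    · intro x b y
      unfold logIncrement noise
      fun_prop
    · exact ((h.measurable_logIncrement γ B κ V v t).mono (ℱ.le _) le_rfl).exp.ennreal_ofReal
    · have : Measurable[ℱ t] fun ω => ∑ ℓ ∈ Finset.range t,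
          logIncrement M γ B κ V v (s ℓ ω) (a ℓ ω) (r ℓ ω) (s' ℓ ω) :=
        Finset.measurable_sum _ fun ℓ hℓ => (h.measurable_logIncrement γ B κ V v ℓ).mono
          (ℱ.mono (Nat.succ_le_of_lt (Finset.mem_range.1 hℓ))) le_rfl
      exact this.exp.ennreal_ofReal

/-- Markov's inequality at level card K / ε for each index, then a union bound over K. -/
theorem IsSampling.measure_exists_le_sum_logIncrement_le (h : IsSampling M P ℱ s a r s') {γ B : ℝ}
    (hγ : 0 ≤ γ) (hB : 1 + γ * B = B) (hB0 : 0 ≤ B) (κ : ℝ) {ι : Type*} (K : Finset ι)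
    {V : ι → S → ℝ} (hV : ∀ i x, V i x ∈ Set.Icc 0 B) (v : ι → Fin d → ℝ) (t : ℕ) {ε : ℝ}
    (hε : 0 < ε) :
    P {ω | ∃ i ∈ K, Real.log (K.card / ε) ≤ ∑ ℓ ∈ Finset.range t,
      logIncrement M γ B κ (V i) (v i) (s ℓ ω) (a ℓ ω) (r ℓ ω) (s' ℓ ω)} ≤ ENNReal.ofReal ε := by
  rcases K.eq_empty_or_nonempty with rfl | hK
  · simp
  have hK0 : (0 : ℝ) < K.card := by exact_mod_cast hK.card_pos
  have hone : ∀ i, P {ω | Real.log (K.card / ε) ≤ ∑ ℓ ∈ Finset.range t,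
      logIncrement M γ B κ (V i) (v i) (s ℓ ω) (a ℓ ω) (r ℓ ω) (s' ℓ ω)} ≤
        ENNReal.ofReal (ε / K.card) := by
    intro i
    have hm : Measurable fun ω => ENNReal.ofReal (Real.exp (∑ ℓ ∈ Finset.range t,
        logIncrement M γ B κ (V i) (v i) (s ℓ ω) (a ℓ ω) (r ℓ ω) (s' ℓ ω))) :=
      (Finset.measurable_sum _ fun ℓ _ => (h.measurable_logIncrement γ B κ (V i) (v i) ℓ).mono
          (ℱ.le _) le_rfl).exp.ennreal_ofReal
    have hMk := meas_ge_le_lintegral_div (μ := P) hm.aemeasurable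
      (ε := ENNReal.ofReal (K.card / ε)) (by simp; positivity) ENNReal.ofReal_ne_top
    refine le_trans (measure_mono fun ω hω => ?_) (hMk.trans ?_)
    · refine ENNReal.ofReal_le_ofReal ?_
      rw [← Real.exp_log (show (0 : ℝ) < K.card / ε by positivity)]
      exact Real.exp_le_exp.2 hω
    · refine (ENNReal.div_le_div_right (h.lintegral_exp_sum_le_one hγ hB hB0 κ (hV i) (v i) t)
        _).trans (le_of_eq ?_)
      rw [one_div, ← ENNReal.ofReal_inv_of_pos (by positivity), inv_div]
  calc _ ≤ P (⋃ i ∈ K, {ω | Real.log (K.card / ε) ≤ ∑ ℓ ∈ Finset.range t,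
      logIncrement M γ B κ (V i) (v i) (s ℓ ω) (a ℓ ω) (r ℓ ω) (s' ℓ ω)}) :=
        measure_mono fun ω hω => by
          obtain ⟨i, hi, hω⟩ := hω
          simp only [Set.mem_iUnion]
          exact ⟨i, hi, hω⟩
    _ ≤ ∑ i ∈ K, ENNReal.ofReal (ε / K.card) :=
        (measure_biUnion_finset_le _ _).trans (Finset.sum_le_sum fun i _ => hone i)
    _ = ENNReal.ofReal ε := by
        rw [Finset.sum_const, nsmul_eq_mul, ← ENNReal.ofReal_natCast,
          ← ENNReal.ofReal_mul hK0.le, mul_div_cancel₀ _ hK0.ne']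

end ExponentialBound

/-! ### Ridge regression and the design norm -/

section Ridge

variable {S A : Type*} {d : ℕ}

/-- These are the normal equations paired with a test vector v; positivity of `lam` makes the Gram
matrix invertible. -/
theorem sum_mul_ridge_add {lam : ℝ} (hlam : 0 < lam) (φ : S → A → Fin d → ℝ) (s : ℕ → S)
    (a : ℕ → A) (y : ℕ → ℝ) (t : ℕ) (v : Fin d → ℝ) :
    ∑ ℓ ∈ Finset.range t, (φ (s ℓ) (a ℓ) ⬝ᵥ ridge lam φ s a y t) * (φ (s ℓ) (a ℓ) ⬝ᵥ v) +
        lam * (ridge lam φ s a y t ⬝ᵥ v) =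
      ∑ ℓ ∈ Finset.range t, y ℓ * (φ (s ℓ) (a ℓ) ⬝ᵥ v) := by
  set D := designMatrix φ s a t with hD
  have hpd : (Dᵀ * D + lam • (1 : Matrix (Fin d) (Fin d) ℝ)).PosDef :=
    PosDef.posSemidef_add (posSemidef_conjTranspose_mul_self D) (PosDef.one.smul hlam)
  have hdet : IsUnit (Dᵀ * D + lam • (1 : Matrix (Fin d) (Fin d) ℝ)).det :=
    hpd.det_pos.ne'.isUnit
  have h1 : (Dᵀ * D + lam • (1 : Matrix (Fin d) (Fin d) ℝ)) *ᵥ ridge lam φ s a y t =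
      Dᵀ *ᵥ fun ℓ : Fin t => y ℓ := by
    rw [ridge, mulVec_mulVec, mul_nonsing_inv _ hdet, one_mulVec]
  have h2 := congrArg (fun z => z ⬝ᵥ v) h1
  simp only [add_mulVec, add_dotProduct, ← mulVec_mulVec, smul_mulVec, one_mulVec,
    smul_dotProduct, smul_eq_mul, mulVec_transpose, ← dotProduct_mulVec] at h2
  rw [← Fin.sum_univ_eq_sum_range (fun ℓ => (φ (s ℓ) (a ℓ) ⬝ᵥ ridge lam φ s a y t) *
    (φ (s ℓ) (a ℓ) ⬝ᵥ v)), ← Fin.sum_univ_eq_sum_range (fun ℓ => y ℓ * (φ (s ℓ) (a ℓ) ⬝ᵥ v))]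
  exact h2

/-- The estimator is linear in its responses, and ∑ V(x) 1{x = s'} = V(s'). -/
theorem thetaHat_add_sum_muHat [Fintype S] (lam γ : ℝ) (φ : S → A → Fin d → ℝ) (s : ℕ → S)
    (a : ℕ → A) (r : ℕ → ℝ) (s' : ℕ → S) (t : ℕ) (V : S → ℝ) :
    thetaHat lam φ s a r t + γ • ∑ x, V x • muHat lam φ s a s' t x =
      ridge lam φ s a (fun ℓ => r ℓ + γ * V (s' ℓ)) t := by
  classical
  simp only [thetaHat, muHat, ridge, ← mulVec_smul, ← mulVec_sum, ← mulVec_add]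
  congr 2
  ext ℓ
  simp [Finset.sum_apply]

theorem sqNorm_featureMatrix_freq [Fintype S] [Fintype A] (φ : S → A → Fin d → ℝ) (s : ℕ → S)
    (a : ℕ → A) {t : ℕ} (ht : 1 ≤ t) (u : Fin d → ℝ) :
    sqNorm ((t : ℝ) • featureMatrix φ (freq s a t)) u =
      ∑ ℓ ∈ Finset.range t, (φ (s ℓ) (a ℓ) ⬝ᵥ u) ^ 2 := by
  classical
  have ht0 : (t : ℝ) ≠ 0 := by positivity
  have hcard : ∀ x b, (t : ℝ) * freq s a t x b =
      ∑ ℓ ∈ Finset.range t, if s ℓ = x ∧ a ℓ = b then 1 else 0 := by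
    intro x b
    rw [freq, mul_div_cancel₀ _ ht0, Finset.sum_boole]
  have hq : ∀ x b, u ⬝ᵥ (vecMulVec (φ x b) (φ x b) *ᵥ u) = (φ x b ⬝ᵥ u) ^ 2 := by
    intro x b
    rw [vecMulVec_mulVec, dotProduct_comm]
    simp [sq]
  simp only [sqNorm, featureMatrix, smul_mulVec, sum_mulVec, dotProduct_smul, dotProduct_sum, hq,
    smul_eq_mul, Finset.mul_sum, ← mul_assoc, hcard, Finset.sum_mul]
  simp_rw [Finset.sum_comm (s := Finset.univ) (t := Finset.range t)]
  refine Finset.sum_congr rfl fun ℓ _ => ?_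
  rw [Finset.sum_eq_single (s ℓ), Finset.sum_eq_single (a ℓ)]
  · simp
  all_goals simp +contextual [eq_comm]

end Ridge

/-! ### Lattice covering and the effect of discretization -/

section Bounds

variable {d : ℕ}

theorem zero_le_dotProduct_self (v : Fin d → ℝ) : 0 ≤ v ⬝ᵥ v :=
  Finset.sum_nonneg fun i _ => mul_self_nonneg (v i)

theorem norm_toLp_sq (v : Fin d → ℝ) : ‖WithLp.toLp 2 v‖ ^ 2 = v ⬝ᵥ v := by
  rw [EuclideanSpace.norm_sq_eq]
  simp [dotProduct, sq]

theorem abs_apply_le_norm_toLp (v : Fin d → ℝ) (i : Fin d) : |v i| ≤ ‖WithLp.toLp 2 v‖ := by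
  simpa using PiLp.norm_apply_le (WithLp.toLp 2 v) i

theorem abs_dotProduct_le {f v : Fin d → ℝ} (hf : ‖WithLp.toLp 2 f‖ ≤ 1) {h : ℝ}
    (hv : ∀ i, |v i| ≤ h) : |f ⬝ᵥ v| ≤ d * h := by
  refine (Finset.abs_sum_le_sum_abs _ _).trans ?_
  refine (Finset.sum_le_card_nsmul _ _ h fun i _ => ?_).trans (by simp)
  rw [abs_mul]
  have h1 := (abs_apply_le_norm_toLp f i).trans hf
  nlinarith [abs_nonneg (v i), abs_nonneg (f i), hv i]

/-- The points of the lattice `h ℤ^d`. -/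
noncomputable def gridPoint (h : ℝ) (j : Fin d → ℤ) : Fin d → ℝ := fun i => h * j i

/-- The indices of the lattice points in a cube. -/
noncomputable def gridIndex (d J : ℕ) : Finset (Fin d → ℤ) :=
  Fintype.piFinset fun _ => Finset.Icc (-(J : ℤ)) J

theorem card_gridIndex (d J : ℕ) : (gridIndex d J).card = (2 * J + 1) ^ d := by
  simp only [gridIndex, Fintype.card_piFinset, Int.card_Icc, Finset.prod_const, Finset.card_univ,
    Fintype.card_fin]
  congr 1
  omega

theorem exists_gridPoint {h : ℝ} (hh : 0 < h) {J : ℕ} {v : Fin d → ℝ} (hv : ∀ i, |v i| ≤ h * J) :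
    ∃ j ∈ gridIndex d J, ∀ i, |(v - gridPoint h j) i| ≤ h := by
  refine ⟨fun i => ⌊v i / h⌋, ?_, fun i => ?_⟩
  · simp only [gridIndex, Fintype.mem_piFinset, Finset.mem_Icc]
    intro i
    have h1 := abs_le.1 (hv i)
    constructor
    · rw [Int.le_floor, le_div_iff₀ hh]
      push_cast
      linarith
    · rw [← @Int.cast_le ℝ]
      refine (Int.floor_le _).trans ?_
      rw [div_le_iff₀ hh]
      push_cast
      linarith
  · have h1 := mul_le_mul_of_nonneg_left (Int.floor_le (v i / h)) hh.le
    have h2 := mul_le_mul_of_nonneg_left (Int.lt_floor_add_one (v i / h)).le hh.le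
    rw [mul_div_cancel₀ _ hh.ne'] at h1 h2
    simp only [Pi.sub_apply, gridPoint]
    rw [abs_of_nonneg (by linarith)]
    linarith

/-- The greedy value of the linear function with parameter `w`, truncated to `[0, B]`. -/
noncomputable def greedyValue {S A : Type*} (φ : S → A → Fin d → ℝ) (B : ℝ) (w : Fin d → ℝ)
    (x : S) : ℝ :=
  max 0 (min B (⨆ b, φ x b ⬝ᵥ w))

theorem greedyValue_mem_Icc {S A : Type*} (φ : S → A → Fin d → ℝ) {B : ℝ} (hB : 0 ≤ B)
    (w : Fin d → ℝ) (x : S) : greedyValue φ B w x ∈ Set.Icc 0 B :=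
  ⟨le_max_left _ _, max_le hB (min_le_left _ _)⟩

/-- A maximum over actions is 1-Lipschitz in the sup norm, and truncation to an interval containing
c does not increase the distance to c. Truncation keeps the values at lattice points inside [0, B],
as Hoeffding requires. -/
theorem abs_sub_greedyValue_le {S A : Type*} [Finite A] {φ : S → A → Fin d → ℝ} {B δ : ℝ}
    {w w' : Fin d → ℝ} {x : S} {c : ℝ} (hc : IsGreatest (Set.range fun b => φ x b ⬝ᵥ w) c)
    (hcB : c ∈ Set.Icc 0 B) (hw : ∀ b, |φ x b ⬝ᵥ (w - w')| ≤ δ) :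
    |c - greedyValue φ B w' x| ≤ δ := by
  obtain ⟨b₀, hb₀⟩ := hc.1
  have : Nonempty A := ⟨b₀⟩
  have hbdd : BddAbove (Set.range fun b => φ x b ⬝ᵥ w') := (Set.finite_range _).bddAbove
  simp only [dotProduct_sub] at hw
  have h1 : (⨆ b, φ x b ⬝ᵥ w') ≤ c + δ := by
    refine ciSup_le fun b => ?_
    have := hc.2 ⟨b, rfl⟩
    have h2 := abs_le.1 (hw b)
    simp only at this
    linarith
  have h2 : c - δ ≤ ⨆ b, φ x b ⬝ᵥ w' := by
    refine le_trans ?_ (le_ciSup hbdd b₀)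
    have h2 := abs_le.1 (hw b₀)
    simp only at hb₀ ⊢
    linarith
  have hδ : 0 ≤ δ := (abs_nonneg _).trans (hw b₀)
  obtain ⟨h3, h4⟩ := hcB
  rw [greedyValue, abs_le]
  constructor
  · have : max 0 (min B (⨆ b, φ x b ⬝ᵥ w')) ≤ c + δ :=
      max_le (by linarith) ((min_le_right _ _).trans h1)
    linarith
  · have : c - δ ≤ max 0 (min B (⨆ b, φ x b ⬝ᵥ w')) :=
      le_max_of_le_right (le_min (by linarith) h2)
    linarith

/-- At κ = 4/B² the quadratic compensator is (2/B²)∑x'², so ∑x'η' ≤ B²L/4 + ∑x'²/2. Half of ∑x² is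
absorbed on the left; the discretization errors B²/3 in ∑ηx and B²/3 in ∑x'², together with the bias
B²/4, leave 3B²/4 before doubling. -/
theorem sum_sq_le_of_perturbation {t : ℕ} (ht : 1 ≤ t) {B L : ℝ} (hB : 0 < B)
    {x x' η η' : ℕ → ℝ}
    (hQ : ∑ ℓ ∈ Finset.range t, x ℓ ^ 2 ≤ ∑ ℓ ∈ Finset.range t, η ℓ * x ℓ + B ^ 2 / 4)
    (hx : ∀ ℓ ∈ Finset.range t, |x ℓ| ≤ 2 * t * B)
    (hxx : ∀ ℓ, |x ℓ - x' ℓ| ≤ B / (15 * t ^ 2))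
    (hηη : ∀ ℓ, |η ℓ - η' ℓ| ≤ 2 * (B / (15 * t ^ 2)))
    (hη : ∀ ℓ, |η' ℓ| ≤ B)
    (hL : ∑ ℓ ∈ Finset.range t,
      (4 / B ^ 2 * x' ℓ * η' ℓ - (4 / B ^ 2) ^ 2 * B ^ 2 / 8 * x' ℓ ^ 2) ≤ L) :
    ∑ ℓ ∈ Finset.range t, x ℓ ^ 2 ≤ B ^ 2 * (L / 2 + 3 / 2) := by
  have ht1 : (1 : ℝ) ≤ t := by exact_mod_cast ht
  have ht0 : (0 : ℝ) < t := by linarith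
  set e := B / (15 * t ^ 2) with he
  have he0 : 0 < e := by positivity
  -- Since e t² = B/15, the two terms are at most 4B²/15 and B²/15; this fixes the constant 15.
  have hte : t * (2 * t * B * (2 * e) + B * e) ≤ B ^ 2 / 3 := by
    have h1 : e * t ^ 2 = B / 15 := by rw [he]; field_simp
    have h2 : t * (2 * t * B * (2 * e) + B * e) = 4 * B * (e * t ^ 2) + B * e * t := by ring
    have h3 : e * t ≤ e * t ^ 2 := by
      apply mul_le_mul_of_nonneg_left _ he0.le
      nlinarith
    rw [h2, h1]
    nlinarith
  have hte' : t * (e * (4 * t * B + e)) ≤ B ^ 2 / 3 := by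
    refine le_trans ?_ hte
    have : e ≤ B := by
      rw [he]
      apply div_le_self hB.le
      nlinarith
    apply mul_le_mul_of_nonneg_left _ ht0.le
    nlinarith
  have h1 : ∑ ℓ ∈ Finset.range t, η ℓ * x ℓ ≤ ∑ ℓ ∈ Finset.range t, x' ℓ * η' ℓ + B ^ 2 / 3 := by
    have : ∑ ℓ ∈ Finset.range t, (η ℓ * x ℓ - x' ℓ * η' ℓ) ≤
        t * (2 * t * B * (2 * e) + B * e) := by
      refine (Finset.sum_le_card_nsmul _ _ (2 * t * B * (2 * e) + B * e) fun ℓ hℓ => ?_).trans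
        (by simp only [Finset.card_range, nsmul_eq_mul, le_refl])
      have h2 : η ℓ * x ℓ - x' ℓ * η' ℓ = x ℓ * (η ℓ - η' ℓ) + η' ℓ * (x ℓ - x' ℓ) := by ring
      rw [h2]
      refine add_le_add ((le_abs_self _).trans ?_) ((le_abs_self _).trans ?_)
      · rw [abs_mul]
        exact mul_le_mul (hx ℓ hℓ) (hηη ℓ) (abs_nonneg _) (by positivity)
      · rw [abs_mul]
        exact mul_le_mul (hη ℓ) (hxx ℓ) (abs_nonneg _) hB.le
    rw [Finset.sum_sub_distrib] at this
    linarith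
  have h2 : ∑ ℓ ∈ Finset.range t, x' ℓ ^ 2 ≤ ∑ ℓ ∈ Finset.range t, x ℓ ^ 2 + B ^ 2 / 3 := by
    have : ∑ ℓ ∈ Finset.range t, (x' ℓ ^ 2 - x ℓ ^ 2) ≤ t * (e * (4 * t * B + e)) := by
      refine (Finset.sum_le_card_nsmul _ _ (e * (4 * t * B + e)) fun ℓ hℓ => ?_).trans
        (by simp only [Finset.card_range, nsmul_eq_mul, le_refl])
      have h3 : x' ℓ ^ 2 - x ℓ ^ 2 = (x ℓ - x' ℓ) * ((x ℓ - x' ℓ) - 2 * x ℓ) := by ring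
      rw [h3]
      refine (le_abs_self _).trans ?_
      rw [abs_mul]
      refine mul_le_mul (hxx ℓ) ((abs_sub _ _).trans ?_) (abs_nonneg _) he0.le
      rw [abs_mul, abs_two]
      linarith [hx ℓ hℓ, hxx ℓ]
    rw [Finset.sum_sub_distrib] at this
    linarith
  have h3 : 4 / B ^ 2 * ∑ ℓ ∈ Finset.range t, x' ℓ * η' ℓ -
      2 / B ^ 2 * ∑ ℓ ∈ Finset.range t, x' ℓ ^ 2 ≤ L := by
    refine le_trans (le_of_eq ?_) hL
    rw [Finset.mul_sum, Finset.mul_sum, ← Finset.sum_sub_distrib]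
    refine Finset.sum_congr rfl fun ℓ _ => ?_
    field_simp
    ring
  have h4 : 4 * ∑ ℓ ∈ Finset.range t, x' ℓ * η' ℓ - 2 * ∑ ℓ ∈ Finset.range t, x' ℓ ^ 2 ≤
      B ^ 2 * L := by
    have := mul_le_mul_of_nonneg_left h3 (sq_nonneg B)
    refine le_trans (le_of_eq ?_) this
    field_simp
  nlinarith

end Bounds

/-! ### Bounds on the true model -/

section Model

variable {S A : Type*} [Fintype S] {d : ℕ} {φ : S → A → Fin d → ℝ}

theorem integral_reward_mem_Icc (M : LinearMDP S A d φ) (x : S) (b : A) :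
    ∫ ρ, ρ ∂M.q x b ∈ Set.Icc (0 : ℝ) 1 := by
  have := M.q_prob x b
  have hae : ∀ᵐ ρ ∂M.q x b, ρ ∈ Set.Icc (0 : ℝ) 1 := M.q_supp x b
  refine ⟨integral_nonneg_of_ae (hae.mono fun ρ hρ => hρ.1), ?_⟩
  by_cases hi : Integrable (fun ρ : ℝ => ρ) (M.q x b)
  · simpa using integral_mono_ae hi (integrable_const 1) (hae.mono fun ρ hρ => hρ.2)
  -- This case cannot occur for a law on [0, 1]; the default value 0 of the integral settles it
  -- without a proof of integrability.
  · rw [integral_undef hi]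
    exact zero_le_one

theorem sum_p_mul_mem_Icc (M : LinearMDP S A d φ) {l c : ℝ} {V : S → ℝ}
    (hV : ∀ x, V x ∈ Set.Icc l c) (x : S) (b : A) : ∑ y, M.p x b y * V y ∈ Set.Icc l c := by
  constructor
  · calc l = ∑ y, M.p x b y * l := by rw [← Finset.sum_mul, M.p_sum, one_mul]
      _ ≤ _ := Finset.sum_le_sum fun y _ =>
        mul_le_mul_of_nonneg_left (hV y).1 (M.p_nonneg x b y)
  · calc _ ≤ ∑ y, M.p x b y * c := Finset.sum_le_sum fun y _ =>
          mul_le_mul_of_nonneg_left (hV y).2 (M.p_nonneg x b y)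
      _ = c := by rw [← Finset.sum_mul, M.p_sum, one_mul]

theorem dotProduct_valueParam_mem_Icc (M : LinearMDP S A d φ) {γ B : ℝ} (hγ : 0 ≤ γ)
    (hB : 1 + γ * B = B) {V : S → ℝ} (hV : ∀ x, V x ∈ Set.Icc 0 B) (x : S) (b : A) :
    φ x b ⬝ᵥ valueParam M γ V ∈ Set.Icc 0 B := by
  rw [dotProduct_valueParam]
  obtain ⟨h1, h2⟩ := integral_reward_mem_Icc M x b
  obtain ⟨h3, h4⟩ := sum_p_mul_mem_Icc M hV x b
  have h5 := mul_le_mul_of_nonneg_left h4 hγ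
  exact ⟨by positivity, by linarith⟩

theorem abs_noise_le (M : LinearMDP S A d φ) {γ B : ℝ} (hγ : 0 ≤ γ)
    (hB : 1 + γ * B = B) {V : S → ℝ} (hV : ∀ x, V x ∈ Set.Icc 0 B) (x : S) (b : A) {ρ : ℝ}
    (hρ : ρ ∈ Set.Icc (0 : ℝ) 1) (y : S) : |noise M γ V x b ρ y| ≤ B := by
  obtain ⟨h1, h2⟩ := dotProduct_valueParam_mem_Icc M hγ hB hV x b
  have h3 := mul_nonneg hγ (hV y).1
  have h4 := mul_le_mul_of_nonneg_left (hV y).2 hγ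
  rw [noise, abs_le]
  constructor <;> linarith [hρ.1, hρ.2]

/-- The rewards cancel, leaving γ times V - V' at y minus its mean under `M.p x b`. -/
theorem abs_noise_sub_le (M : LinearMDP S A d φ) {γ δ : ℝ} (hγ : γ ∈ Set.Ioo (0 : ℝ) 1)
    {V V' : S → ℝ} (hV : ∀ x, |V x - V' x| ≤ δ) (x : S) (b : A) (ρ : ℝ) (y : S) :
    |noise M γ V x b ρ y - noise M γ V' x b ρ y| ≤ 2 * δ := by
  have h0 : 0 ≤ δ := (abs_nonneg _).trans (hV y)
  have h1 : noise M γ V x b ρ y - noise M γ V' x b ρ y =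
      γ * ((V y - V' y) - ∑ z, M.p x b z * (V z - V' z)) := by
    simp only [noise, dotProduct_valueParam, mul_sub, Finset.sum_sub_distrib]
    ring
  obtain ⟨h2, h3⟩ := sum_p_mul_mem_Icc M (fun x => abs_le.1 (hV x)) x b
  obtain ⟨h4, h5⟩ := abs_le.1 (hV y)
  rw [h1, abs_mul, abs_of_pos hγ.1]
  have h6 : |(V y - V' y) - ∑ z, M.p x b z * (V z - V' z)| ≤ 2 * δ := by
    rw [abs_le]
    constructor <;> linarith
  nlinarith [hγ.2, hγ.1, abs_nonneg ((V y - V' y) - ∑ z, M.p x b z * (V z - V' z))]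

/-- Coordinatewise |∑ V μ| ≤ B ∑ |μ|, so the norm is at most √d (1 + γB) = √d B. -/
theorem norm_valueParam_le (M : LinearMDP S A d φ) {γ B : ℝ} (hγ : 0 ≤ γ)
    (hB : 1 + γ * B = B) {V : S → ℝ} (hV : ∀ x, V x ∈ Set.Icc 0 B) (hB0 : 0 ≤ B) :
    ‖WithLp.toLp 2 (valueParam M γ V)‖ ≤ √d * B := by
  have h1 : ‖WithLp.toLp 2 (∑ x, V x • M.μ x)‖ ≤
      ‖WithLp.toLp 2 (B • fun i => ∑ x, |M.μ x i|)‖ := by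
    rw [EuclideanSpace.norm_eq, EuclideanSpace.norm_eq]
    refine Real.sqrt_le_sqrt (Finset.sum_le_sum fun i _ => ?_)
    refine pow_le_pow_left₀ (norm_nonneg _) ?_ 2
    simp only [Finset.sum_apply, Pi.smul_apply, smul_eq_mul, Real.norm_eq_abs, Finset.mul_sum]
    rw [abs_of_nonneg (Finset.sum_nonneg fun x _ => mul_nonneg hB0 (abs_nonneg _))]
    refine (Finset.abs_sum_le_sum_abs _ _).trans (Finset.sum_le_sum fun x _ => ?_)
    rw [abs_mul, abs_of_nonneg (hV x).1]
    exact mul_le_mul_of_nonneg_right (hV x).2 (abs_nonneg _)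
  rw [WithLp.toLp_smul, norm_smul, Real.norm_eq_abs, abs_of_nonneg hB0] at h1
  rw [valueParam, WithLp.toLp_add, WithLp.toLp_smul]
  refine (norm_add_le _ _).trans ?_
  rw [norm_smul, Real.norm_eq_abs, abs_of_nonneg hγ]
  calc _ ≤ √d + γ * (B * √d) := by
        gcongr
        · exact M.θ_norm
        · exact h1.trans (mul_le_mul_of_nonneg_left M.μ_norm hB0)
    _ = √d * B := by linear_combination √d * hB

end Model

/-! ### Pathwise regression bounds -/

section Deterministic

variable {S A : Type*} {d : ℕ} {φ : S → A → Fin d → ℝ}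

/-- Test the normal equations with the estimator itself and use 2yz ≤ y² + z². This a priori bound
confines the estimator to a bounded cube, so that a finite lattice suffices. -/
theorem sum_sq_ridge_le (φ : S → A → Fin d → ℝ) {lam : ℝ} (hlam : 0 < lam) (s : ℕ → S) (a : ℕ → A)
    {y : ℕ → ℝ} {B : ℝ} (hy : ∀ ℓ, |y ℓ| ≤ B) (t : ℕ) :
    ∑ ℓ ∈ Finset.range t, (φ (s ℓ) (a ℓ) ⬝ᵥ ridge lam φ s a y t) ^ 2 +
      2 * lam * (ridge lam φ s a y t ⬝ᵥ ridge lam φ s a y t) ≤ t * B ^ 2 := by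
  have h := sum_mul_ridge_add hlam φ s a y t (ridge lam φ s a y t)
  have h1 : ∑ ℓ ∈ Finset.range t, y ℓ * (φ (s ℓ) (a ℓ) ⬝ᵥ ridge lam φ s a y t) ≤
      ∑ ℓ ∈ Finset.range t, (B ^ 2 / 2 + (φ (s ℓ) (a ℓ) ⬝ᵥ ridge lam φ s a y t) ^ 2 / 2) := by
    refine Finset.sum_le_sum fun ℓ _ => ?_
    have : y ℓ ^ 2 ≤ B ^ 2 := sq_le_sq' (abs_le.1 (hy ℓ)).1 (abs_le.1 (hy ℓ)).2
    nlinarith [sq_nonneg (y ℓ - φ (s ℓ) (a ℓ) ⬝ᵥ ridge lam φ s a y t)]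
  rw [Finset.sum_add_distrib, Finset.sum_const, Finset.card_range, nsmul_eq_mul,
    ← Finset.sum_div] at h1
  simp only [← sq] at h
  linarith

/-- Test the normal equations with u = v - w. The regularization leaves -lam(‖u‖² + wᵀu), at most
lam‖w‖²/4 by completing the square in u + w/2. -/
theorem sum_sq_ridge_sub_le {lam : ℝ} (hlam : 0 < lam) (φ : S → A → Fin d → ℝ) (s : ℕ → S)
    (a : ℕ → A) (y : ℕ → ℝ) (t : ℕ) (w : Fin d → ℝ) :
    ∑ ℓ ∈ Finset.range t, (φ (s ℓ) (a ℓ) ⬝ᵥ (ridge lam φ s a y t - w)) ^ 2 ≤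
      ∑ ℓ ∈ Finset.range t, (y ℓ - φ (s ℓ) (a ℓ) ⬝ᵥ w) *
        (φ (s ℓ) (a ℓ) ⬝ᵥ (ridge lam φ s a y t - w)) + lam * (w ⬝ᵥ w) / 4 := by
  have h := sum_mul_ridge_add hlam φ s a y t (ridge lam φ s a y t - w)
  set v := ridge lam φ s a y t
  have h1 : ∑ ℓ ∈ Finset.range t, (φ (s ℓ) (a ℓ) ⬝ᵥ (v - w)) ^ 2 =
      ∑ ℓ ∈ Finset.range t, (φ (s ℓ) (a ℓ) ⬝ᵥ v) * (φ (s ℓ) (a ℓ) ⬝ᵥ (v - w)) -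
      ∑ ℓ ∈ Finset.range t, (φ (s ℓ) (a ℓ) ⬝ᵥ w) * (φ (s ℓ) (a ℓ) ⬝ᵥ (v - w)) := by
    rw [← Finset.sum_sub_distrib]
    refine Finset.sum_congr rfl fun ℓ _ => ?_
    rw [← sub_mul, ← dotProduct_sub, sq]
  have h2 : 0 ≤ lam * (((v - w) + (1 / 2 : ℝ) • w) ⬝ᵥ ((v - w) + (1 / 2 : ℝ) • w)) :=
    mul_nonneg hlam.le (zero_le_dotProduct_self _)
  simp only [sub_mul, Finset.sum_sub_distrib]
  rw [h1]
  simp only [dotProduct_add, add_dotProduct, smul_dotProduct, dotProduct_smul, smul_eq_mul,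
    dotProduct_sub, sub_dotProduct, dotProduct_comm w v] at h h2 ⊢
  nlinarith

variable [Fintype S] [Fintype A]

/-- Lattice points near v and v - w replace the data-dependent value function and direction, and the
hypothesis applies to that pair. -/
theorem sqNorm_le_of_sum_logIncrement_le (hφ : ∀ x b, ‖WithLp.toLp 2 (φ x b)‖ ≤ 1)
    (M : LinearMDP S A d φ) {γ B : ℝ} (hγ : γ ∈ Set.Ioo (0 : ℝ) 1) (hB : 1 + γ * B = B)
    (hB0 : 0 < B) (hd : 1 ≤ d) {s : ℕ → S} {a : ℕ → A} {r : ℕ → ℝ} {s' : ℕ → S}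
    (hr : ∀ ℓ, r ℓ ∈ Set.Icc (0 : ℝ) 1) {t : ℕ} (ht : 1 ≤ t) {L : ℝ}
    (hL : ∀ j ∈ gridIndex d (30 * d ^ 2 * t ^ 3) ×ˢ gridIndex d (30 * d ^ 2 * t ^ 3),
      ∑ ℓ ∈ Finset.range t, logIncrement M γ B (4 / B ^ 2)
        (greedyValue φ B (gridPoint (B / (15 * d * t ^ 2)) j.1))
        (gridPoint (B / (15 * d * t ^ 2)) j.2) (s ℓ) (a ℓ) (r ℓ) (s' ℓ) ≤ L)
    {V : S → ℝ} (hV : IsOptimalValue γ φ (thetaHat (1 / (d : ℝ)) φ s a r t)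
      (muHat (1 / (d : ℝ)) φ s a s' t) V) (hVB : ∀ x, V x ∈ Set.Icc 0 B) :
    sqNorm ((t : ℝ) • featureMatrix φ (freq s a t))
      (thetaHat (1 / (d : ℝ)) φ s a r t - M.θ +
        γ • ∑ x, V x • (muHat (1 / (d : ℝ)) φ s a s' t x - M.μ x)) ≤
      B ^ 2 * (L / 2 + 3 / 2) := by
  have hd1 : (1 : ℝ) ≤ d := by exact_mod_cast hd
  have ht1 : (1 : ℝ) ≤ t := by exact_mod_cast ht
  have hd0 : (0 : ℝ) < d := by linarith
  have ht0 : (0 : ℝ) < t := by linarith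
  have hlam : (0 : ℝ) < 1 / d := by positivity
  set y : ℕ → ℝ := fun ℓ => r ℓ + γ * V (s' ℓ) with hy
  set v := ridge (1 / (d : ℝ)) φ s a y t with hv
  set w := valueParam M γ V with hw
  have hu : thetaHat (1 / (d : ℝ)) φ s a r t - M.θ +
        γ • ∑ x, V x • (muHat (1 / (d : ℝ)) φ s a s' t x - M.μ x) = v - w := by
    rw [hv, hy, ← thetaHat_add_sum_muHat, hw, valueParam]
    simp only [smul_sub, Finset.sum_sub_distrib]
    abel
  have hgreedy : ∀ x, IsGreatest (Set.range fun b => φ x b ⬝ᵥ v) (V x) := by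
    intro x
    convert hV x using 3 with b
    rw [hv, hy, ← thetaHat_add_sum_muHat]
    simp only [dotProduct_add, dotProduct_smul, dotProduct_sum, smul_eq_mul, mul_comm]
  have hyB : ∀ ℓ, |y ℓ| ≤ B := by
    intro ℓ
    have h3 := mul_nonneg hγ.1.le (hVB (s' ℓ)).1
    have h4 := mul_le_mul_of_nonneg_left (hVB (s' ℓ)).2 hγ.1.le
    rw [hy, abs_le]
    constructor <;> linarith [(hr ℓ).1, (hr ℓ).2]
  have hsum := sum_sq_ridge_le φ hlam s a hyB t
  rw [← hv] at hsum
  have htB : t * B ^ 2 ≤ (t * B) ^ 2 := by nlinarith [mul_pos hB0 hB0]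
  have hφv : ∀ ℓ ∈ Finset.range t, |φ (s ℓ) (a ℓ) ⬝ᵥ v| ≤ t * B := by
    intro ℓ hℓ
    refine abs_le_of_sq_le_sq ?_ (by positivity)
    have h1 := Finset.single_le_sum (f := fun ℓ => (φ (s ℓ) (a ℓ) ⬝ᵥ v) ^ 2)
      (fun _ _ => sq_nonneg _) hℓ
    have h2 : 0 ≤ 2 * (1 / (d : ℝ)) * (v ⬝ᵥ v) :=
      mul_nonneg (by positivity) (zero_le_dotProduct_self v)
    linarith
  have hv_i : ∀ i, |v i| ≤ d * t * B := by
    intro i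
    refine (abs_apply_le_norm_toLp v i).trans (abs_le_of_sq_le_sq' ?_ (by positivity)).2
    rw [norm_toLp_sq]
    have h1 : 0 ≤ ∑ ℓ ∈ Finset.range t, (φ (s ℓ) (a ℓ) ⬝ᵥ v) ^ 2 :=
      Finset.sum_nonneg fun _ _ => sq_nonneg _
    have h2 : 2 * (1 / (d : ℝ)) * (v ⬝ᵥ v) ≤ (t * B) ^ 2 := by linarith
    have h3 := mul_le_mul_of_nonneg_left h2 hd0.le
    have h4 : (d : ℝ) * (2 * (1 / (d : ℝ)) * (v ⬝ᵥ v)) = 2 * (v ⬝ᵥ v) := by field_simp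
    have h5 : (d : ℝ) * (t * B) ^ 2 ≤ (d * t * B) ^ 2 := by
      have : 0 ≤ (t * B) ^ 2 := sq_nonneg _
      nlinarith
    linarith [zero_le_dotProduct_self v]
  have hwn := norm_valueParam_le M hγ.1.le hB hVB hB0.le
  rw [← hw] at hwn
  have hsqd : √(d : ℝ) ≤ d := Real.sqrt_le_iff.2 ⟨hd0.le, by nlinarith⟩
  have hw_i : ∀ i, |w i| ≤ d * t * B := by
    intro i
    refine ((abs_apply_le_norm_toLp w i).trans hwn).trans ?_
    refine mul_le_mul_of_nonneg_right (hsqd.trans ?_) hB0.le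
    nlinarith
  have hww : 1 / (d : ℝ) * (w ⬝ᵥ w) ≤ B ^ 2 := by
    have h1 := pow_le_pow_left₀ (norm_nonneg _) hwn 2
    rw [norm_toLp_sq, mul_pow, Real.sq_sqrt hd0.le] at h1
    rw [one_div, inv_mul_le_iff₀ hd0]
    exact h1
  -- A coordinatewise error h moves φᵀv by at most dh = B/(15t²), the error allowed in
  -- `sum_sq_le_of_perturbation`. The half-width hJ = 2dtB covers v - w, hence also v.
  set h := B / (15 * d * t ^ 2) with hh
  have hh0 : 0 < h := by positivity
  have hhJ : h * (30 * d ^ 2 * t ^ 3 : ℕ) = 2 * (d * t * B) := by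
    rw [hh]
    push_cast
    field_simp
    ring
  have hdh : d * h = B / (15 * t ^ 2) := by
    rw [hh]
    field_simp
  have hdtB : 0 ≤ d * t * B := by positivity
  obtain ⟨j₁, hj₁, hjv⟩ := exists_gridPoint hh0 (J := 30 * d ^ 2 * t ^ 3) (v := v) fun i => by
    rw [hhJ]
    linarith [hv_i i]
  obtain ⟨j₂, hj₂, hju⟩ := exists_gridPoint hh0 (J := 30 * d ^ 2 * t ^ 3) (v := v - w) fun i => by
    rw [hhJ]
    exact (abs_sub _ _).trans (by linarith [hv_i i, hw_i i])
  have hVV : ∀ x, |V x - greedyValue φ B (gridPoint h j₁) x| ≤ B / (15 * t ^ 2) := fun x =>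
    abs_sub_greedyValue_le (hgreedy x) (hVB x) fun b => hdh ▸ abs_dotProduct_le (hφ x b) hjv
  rw [hu, sqNorm_featureMatrix_freq φ s a ht]
  refine sum_sq_le_of_perturbation ht hB0 (x' := fun ℓ => φ (s ℓ) (a ℓ) ⬝ᵥ gridPoint h j₂)
    (η := fun ℓ => noise M γ V (s ℓ) (a ℓ) (r ℓ) (s' ℓ))
    (η' := fun ℓ => noise M γ (greedyValue φ B (gridPoint h j₁)) (s ℓ) (a ℓ) (r ℓ) (s' ℓ))
    ?_ ?_ ?_ ?_ ?_ (hL (j₁, j₂) (Finset.mk_mem_product hj₁ hj₂))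
  · refine (sum_sq_ridge_sub_le hlam φ s a y t w).trans (add_le_add le_rfl ?_)
    linarith
  · intro ℓ hℓ
    rw [dotProduct_sub]
    obtain ⟨h1, h2⟩ := dotProduct_valueParam_mem_Icc M hγ.1.le hB hVB (s ℓ) (a ℓ)
    have h3 := hφv ℓ hℓ
    refine (abs_sub _ _).trans ?_
    rw [abs_of_nonneg h1]
    nlinarith
  · intro ℓ
    rw [← dotProduct_sub, ← hdh]
    exact abs_dotProduct_le (hφ _ _) hju
  · exact fun ℓ => abs_noise_sub_le M hγ hVV _ _ _ _
  · exact fun ℓ => abs_noise_le M hγ.1.le hB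
      (greedyValue_mem_Icc φ hB0.le (gridPoint h j₁)) _ _ (hr ℓ) _

end Deterministic

/-! ### Zeta weights and logarithms -/

section Constants

theorem riemannZeta_two_re : (riemannZeta 2).re = Real.pi ^ 2 / 6 := by
  rw [riemannZeta_two]
  norm_cast

theorem one_le_riemannZeta_two_re : 1 ≤ (riemannZeta 2).re := by
  rw [riemannZeta_two_re]
  nlinarith [Real.pi_gt_three]

theorem tsum_ofReal_div_zeta {δ : ℝ} (hδ : 0 ≤ δ) :
    ∑' t : ℕ, ENNReal.ofReal (δ / ((riemannZeta 2).re * ((t + 1 : ℕ) : ℝ) ^ 2)) =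
      ENNReal.ofReal δ := by
  have h1 := (hasSum_nat_add_iff' 1).2 hasSum_zeta_two
  simp only [Finset.range_one, Finset.sum_singleton, CharP.cast_eq_zero, ne_eq, OfNat.ofNat_ne_zero,
    not_false_eq_true, zero_pow, div_zero, sub_zero, ← riemannZeta_two_re] at h1
  have hζ := one_le_riemannZeta_two_re
  have h2 := h1.mul_left (δ / (riemannZeta 2).re)
  rw [div_mul_cancel₀ _ (by linarith)] at h2
  have h3 : ∀ t : ℕ, δ / ((riemannZeta 2).re * ((t + 1 : ℕ) : ℝ) ^ 2) =
      δ / (riemannZeta 2).re * (1 / ((t + 1 : ℕ) : ℝ) ^ 2) := fun t => by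
    rw [div_mul_div_comm, mul_one]
  simp_rw [h3]
  rw [← ENNReal.ofReal_tsum_of_nonneg (fun t => by positivity) h2.summable, h2.tsum_eq]

theorem one_le_zeta_mul_div {δ : ℝ} (hδ : δ ∈ Set.Ioo (0 : ℝ) 1) {t : ℕ} (ht : 1 ≤ t) :
    1 ≤ (riemannZeta 2).re * (t : ℝ) ^ 2 / δ := by
  have ht1 : (1 : ℝ) ≤ t := by exact_mod_cast ht
  rw [le_div_iff₀ hδ.1]
  have := one_le_riemannZeta_two_re
  have h2 : (1 : ℝ) ≤ t ^ 2 := one_le_pow₀ ht1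
  nlinarith [hδ.2]

theorem log_sqrt_exp_mul {δ : ℝ} (hδ : δ ∈ Set.Ioo (0 : ℝ) 1) {t : ℕ} (ht : 1 ≤ t) :
    Real.log (√(Real.exp 1) * (riemannZeta 2).re * (t : ℝ) ^ 2 / δ) =
      1 / 2 + Real.log ((riemannZeta 2).re * (t : ℝ) ^ 2 / δ) := by
  have h := one_le_zeta_mul_div hδ ht
  rw [mul_assoc, mul_div_assoc, Real.log_mul (by positivity) (by linarith),
    Real.log_sqrt (Real.exp_pos _).le, Real.log_exp]

/-- 60d²t³ + 1 ≤ 64d²t⁴ = (8dt²)²; the factor e⁴ is slack. -/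
theorem log_card_grid_le {d t : ℕ} (hd : 1 ≤ d) (ht : 1 ≤ t) :
    Real.log (2 * (30 * d ^ 2 * t ^ 3 : ℕ) + 1) ≤
      2 * Real.log (8 * Real.exp 1 ^ 4 * d * (t : ℝ) ^ 2) := by
  have hd1 : (1 : ℝ) ≤ d := by exact_mod_cast hd
  have ht1 : (1 : ℝ) ≤ t := by exact_mod_cast ht
  have he : 1 ≤ Real.exp 1 ^ 4 := one_le_pow₀ (Real.one_le_exp zero_le_one)
  rw [← Nat.cast_ofNat (n := 2) (R := ℝ), ← Real.log_pow]
  refine Real.log_le_log (by positivity) ?_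
  push_cast
  have h1 : (1 : ℝ) ≤ d ^ 2 := one_le_pow₀ hd1
  have h2 : (1 : ℝ) ≤ t ^ 3 := one_le_pow₀ ht1
  have h3 : (d : ℝ) ^ 2 * t ^ 3 ≤ d ^ 2 * t ^ 4 := by gcongr; norm_num
  have h4 : (1 : ℝ) ≤ d ^ 2 * t ^ 3 := one_le_mul_of_one_le_of_one_le h1 h2
  calc 2 * (30 * (d : ℝ) ^ 2 * t ^ 3) + 1 ≤ (8 * 1 * d * (t : ℝ) ^ 2) ^ 2 := by nlinarith
    _ ≤ _ := by gcongr

end Constants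

end LinMDP

/-! ### The confidence bound -/

theorem mainTheorem4 {S A : Type*} [Fintype S] [Fintype A]
    [MeasurableSpace S] [MeasurableSingletonClass S]
    [MeasurableSpace A] [MeasurableSingletonClass A]
    {d : ℕ} (φ : S → A → Fin d → ℝ) (hφ : ∀ x b, ‖WithLp.toLp 2 (φ x b)‖ ≤ 1)
    (M : LinMDP.LinearMDP S A d φ)
    (γ : ℝ) (hγ : γ ∈ Set.Ioo (0 : ℝ) 1)
    {Ω : Type*} {mΩ : MeasurableSpace Ω} (P : Measure Ω) [IsProbabilityMeasure P]
    (ℱ : Filtration ℕ mΩ)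
    (s : ℕ → Ω → S) (a : ℕ → Ω → A) (r : ℕ → Ω → ℝ) (s' : ℕ → Ω → S)
    (hsamp : LinMDP.IsSampling M P ℱ s a r s')
    (δ : ℝ) (hδ : δ ∈ Set.Ioo (0 : ℝ) 1) :
    ∃ E : Set Ω, MeasurableSet E ∧ ENNReal.ofReal (1 - δ) ≤ P E ∧
      ∀ ω ∈ E, ∀ t : ℕ, 1 ≤ t →
        let θh : Fin d → ℝ :=
          LinMDP.thetaHat (1 / (d : ℝ)) φ (fun ℓ => s ℓ ω) (fun ℓ => a ℓ ω) (fun ℓ => r ℓ ω) t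
        let μh : S → Fin d → ℝ :=
          LinMDP.muHat (1 / (d : ℝ)) φ (fun ℓ => s ℓ ω) (fun ℓ => a ℓ ω) (fun ℓ => s' ℓ ω) t
        ∀ V : S → ℝ, LinMDP.IsOptimalValue γ φ θh μh V →
          (∀ x, V x ∈ Set.Icc 0 (1 / (1 - γ))) →
          LinMDP.sqNorm
              ((t : ℝ) • LinMDP.featureMatrix φ
                (LinMDP.freq (fun ℓ => s ℓ ω) (fun ℓ => a ℓ ω) t))
              (θh - M.θ + γ • ∑ x, V x • (μh x - M.μ x))
            ≤ 2 / (1 - γ) ^ 2 *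
              (2 * Real.log (√(Real.exp 1) * (riemannZeta 2).re * (t : ℝ) ^ 2 / δ)
                + d * Real.log (8 * Real.exp 1 ^ 4 * d * (t : ℝ) ^ 2)) := by
  open LinMDP in
  have h1γ : 0 < 1 - γ := by linarith [hγ.2]
  -- For d = 0 the spacing of the lattice degenerates, but the left side is an empty sum and the
  -- right side is nonnegative.
  rcases Nat.eq_zero_or_pos d with rfl | hd
  · refine ⟨Set.univ, MeasurableSet.univ, ?_, ?_⟩
    · rw [measure_univ, ENNReal.ofReal_le_one]
      linarith [hδ.1]
    · intro ω _ t ht θh μh V _ _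
      have hlog := Real.log_nonneg (one_le_zeta_mul_div hδ ht)
      rw [log_sqrt_exp_mul hδ ht, sqNorm, dotProduct_of_isEmpty]
      simp only [CharP.cast_eq_zero, zero_mul, add_zero]
      positivity
  set B := 1 / (1 - γ) with hBdef
  have hB0 : 0 < B := by positivity
  have hB : 1 + γ * B = B := by
    rw [hBdef]
    field_simp
    ring
  let K : ℕ → Finset ((Fin d → ℤ) × (Fin d → ℤ)) := fun t =>
    gridIndex d (30 * d ^ 2 * t ^ 3) ×ˢ gridIndex d (30 * d ^ 2 * t ^ 3)
  let ε : ℕ → ℝ := fun t => δ / ((riemannZeta 2).re * (t : ℝ) ^ 2)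
  let bad : ℕ → Set Ω := fun t => {ω | ∃ j ∈ K t, Real.log ((K t).card / ε t) ≤
    ∑ ℓ ∈ Finset.range t, logIncrement M γ B (4 / B ^ 2)
      (greedyValue φ B (gridPoint (B / (15 * d * t ^ 2)) j.1))
      (gridPoint (B / (15 * d * t ^ 2)) j.2) (s ℓ ω) (a ℓ ω) (r ℓ ω) (s' ℓ ω)}
  let N : Set Ω := {ω | ¬ ∀ ℓ, r ℓ ω ∈ Set.Icc (0 : ℝ) 1}
  have hN : P N = 0 := hsamp.ae_reward_mem
  have hζ := one_le_riemannZeta_two_re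
  have hbad : P ((⋃ t, bad (t + 1)) ∪ N) ≤ ENNReal.ofReal δ := by
    refine (measure_union_le _ _).trans ?_
    rw [hN, add_zero, ← tsum_ofReal_div_zeta hδ.1.le]
    refine (measure_iUnion_le _).trans (ENNReal.tsum_le_tsum fun t => ?_)
    refine hsamp.measure_exists_le_sum_logIncrement_le hγ.1.le hB hB0.le (4 / B ^ 2) (K (t + 1))
      (V := fun j => greedyValue φ B (gridPoint (B / (15 * d * ((t + 1 : ℕ) : ℝ) ^ 2)) j.1))
      (fun j => greedyValue_mem_Icc φ hB0.le _)
      (fun j => gridPoint (B / (15 * d * ((t + 1 : ℕ) : ℝ) ^ 2)) j.2) (t + 1) ?_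
    have := hδ.1
    positivity
  -- Passing to a measurable hull of the exceptional set keeps its measure and avoids proving that
  -- set measurable.
  refine ⟨(toMeasurable P ((⋃ t, bad (t + 1)) ∪ N))ᶜ, (measurableSet_toMeasurable _ _).compl, ?_, ?_⟩
  · rw [prob_compl_eq_one_sub (measurableSet_toMeasurable _ _), measure_toMeasurable,
      ENNReal.ofReal_sub _ hδ.1.le, ENNReal.ofReal_one]
    exact tsub_le_tsub_left hbad 1
  intro ω hω t ht θh μh V hV hVB
  have hω' : ω ∉ (⋃ t, bad (t + 1)) ∪ N := fun h => hω (subset_toMeasurable _ _ h)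
  have hr : ∀ ℓ, r ℓ ω ∈ Set.Icc (0 : ℝ) 1 := by
    by_contra h
    exact hω' (Or.inr h)
  have hgood : ω ∉ bad t := fun h => hω' (Or.inl (Set.mem_iUnion.2 ⟨t - 1, by
    rwa [Nat.sub_add_cancel ht]⟩))
  have hL : ∀ j ∈ K t, ∑ ℓ ∈ Finset.range t, logIncrement M γ B (4 / B ^ 2)
      (greedyValue φ B (gridPoint (B / (15 * d * t ^ 2)) j.1))
      (gridPoint (B / (15 * d * t ^ 2)) j.2) (s ℓ ω) (a ℓ ω) (r ℓ ω) (s' ℓ ω) ≤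
        Real.log ((K t).card / ε t) := fun j hj =>
    le_of_not_ge fun h => hgood ⟨j, hj, h⟩
  refine (sqNorm_le_of_sum_logIncrement_le hφ M hγ hB hB0 hd hr ht hL hV hVB).trans ?_
  have hlog := Real.log_nonneg (one_le_zeta_mul_div hδ ht)
  have hcard : Real.log ((K t).card / ε t) = 2 * d * Real.log (2 * (30 * d ^ 2 * t ^ 3 : ℕ) + 1) +
      Real.log ((riemannZeta 2).re * (t : ℝ) ^ 2 / δ) := by
    have h1 : ((K t).card : ℝ) = (2 * (30 * d ^ 2 * t ^ 3 : ℕ) + 1) ^ (2 * d) := by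
      simp only [K, Finset.card_product, card_gridIndex]
      push_cast
      ring
    have h2 : ((K t).card : ℝ) / ε t =
        (K t).card * ((riemannZeta 2).re * (t : ℝ) ^ 2 / δ) := by
      simp only [ε]
      rw [div_div_eq_mul_div, mul_div_assoc]
    rw [h2, Real.log_mul (by rw [h1]; positivity) (by linarith [one_le_zeta_mul_div hδ ht]), h1,
      Real.log_pow]
    push_cast
    ring
  have hgrid := mul_le_mul_of_nonneg_left (log_card_grid_le hd ht) (Nat.cast_nonneg (α := ℝ) d)
  have hB2 : 2 / (1 - γ) ^ 2 = B ^ 2 * 2 := by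
    rw [hBdef]
    field_simp
  -- The √e contributes the constant 2 after scaling, which absorbs the 3/2 from the deterministic
  -- bound.
  rw [hB2, mul_assoc, hcard, log_sqrt_exp_mul hδ ht]
  refine mul_le_mul_of_nonneg_left ?_ (sq_nonneg B)
  linarith
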